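/- Let $G$ be a finite simple unicyclic graph (a connected graph containing exactly one cycle) on $n$ vertices. For a graph $H$ on $n$ vertices with degree matrix $D(H)$ and adjacency matrix $A(H)$, let $Q(H)=D(H)+A(H)$ be its signless Laplacian matrix, and let the signless Laplacian coefficients $\varphi_0(H),\dots,\varphi_n(H)$ be defined by $$\det\bigl(xI-Q(H)\bigr)=\sum_{i=0}^{n}(-1)^i\varphi_i(H)\,x^{n-i}.$$ Let $uv$ be an edge of $G$ which does not lie on the cycle and is not pendent (neither $u$ nor $v$ has degree $1$). Let $G_{uv}$ be the simple graph on $n$ vertices obtained from $G$ by identifying $u$ and $v$ to a single vertex $w$ (deleting the resulting loop) and adding a new vertex $w'$ joined to $w$ only. Then $$\varphi_i(G)\ \ge\ \varphi_i(G_{uv})\qquad\text{for } i=0,1,\dots,n.$$ If $G$ is not bipartite, equality holds for $i$ if and only if $i\in\{0,1,n\}$; if $G$ is bipartite, equality holds for $i$ if and only if $i\in\{0,1,n-1,n\}$. -/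

import Mathlib

namespace SimpleGraph

variable {V : Type*}

/-- The cycles of `G`, each one given by its set of edges. -/
def cycleEdgeSets (G : SimpleGraph V) : Set (Set (Sym2 V)) :=
  {C | ∃ (v : V) (p : G.Walk v v), p.IsCycle ∧ C = {e | e ∈ p.edges}}

/-- A unicyclic graph: a connected graph which contains exactly one cycle. -/
def IsUnicyclic (G : SimpleGraph V) : Prop :=
  G.Connected ∧ ∃! C : Set (Sym2 V), C ∈ G.cycleEdgeSets

open Classical in
/-- A pendent edge: an edge incident to a vertex of degree one. -/
def IsPendentEdge [Fintype V] (G : SimpleGraph V) (e : Sym2 V) : Prop :=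
  e ∈ G.edgeSet ∧ ∃ x ∈ e, G.degree x = 1

open Classical in
/-- The signless Laplacian matrix `Q(G) = D(G) + A(G)`. -/
noncomputable def signlessLapMatrix [Fintype V] (G : SimpleGraph V) : Matrix V V ℝ :=
  G.degMatrix ℝ + G.adjMatrix ℝ

open Classical in
/-- The signless Laplacian coefficient `φ_i(G)`, for `0 ≤ i ≤ n = |V|`, determined by
`det (x I - Q(G)) = ∑_{i=0}^{n} (-1)^i φ_i(G) x^(n-i)`. -/
noncomputable def signlessLapCoeff [Fintype V] (G : SimpleGraph V) (i : ℕ) : ℝ :=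
  (-1) ^ i * G.signlessLapMatrix.charpoly.coeff (Fintype.card V - i)

open Classical in
/-- The graph `G_{uv}` obtained from `G` by identifying `u` and `v` to a vertex `w` and adding a
new vertex `w'` joined to `w` only. It lives on the vertex set of `G`: the merged vertex `w` keeps
the name `u` (the map sends `v` to `u`; loops and repeated edges disappear), and the name `v`,
which the identification sets free, is given to the new vertex `w'`. -/
noncomputable def contractAttach (G : SimpleGraph V) (u v : V) : SimpleGraph V :=
  G.map (fun x => if x = v then u else x) ⊔ edge u v

end SimpleGraph

/-!
`Q(G)` is the sum over the edges `ab` of `G` of the rank-one matrices `(e_a + e_b)(e_a + e_b)ᵀ`.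
Let `H = G - uv` and let `P` push the basis vector `e_v` forward to `e_u`. Since `uv` is a bridge,
`Q(G_{uv})` arises from `Q(G)` by replacing the summand `Q(H)` with `P Q(H) Pᵀ`. As `u` and `v` lie
in different components of `H`, the Schur complement of `x I - Q(H)` on `{u, v}` is diagonal, and a
computation with `2 × 2` determinants shows that `φ_i(G) - φ_i(G_{uv})` is the sum of the principal
minors of order `i` of `Q(H)` whose index sets contain `u` and `v`.

These minors are nonnegative, and the one on `s` vanishes exactly when `s` contains a bipartite
component of `H`: a vector `x` with `x_a = -x_b` on all edges lives on bipartite components. The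
graph `H` has two components, each with at least two vertices because `uv` is not pendent, so a set
containing `u` and `v` can contain neither component if its size is between `2` and `n - 2`, and
contains exactly one, of our choice, if its size is `n - 1`. At least one of the two is a tree
when `G` is unicyclic.
-/

open Matrix Polynomial

section LinearAlgebra

variable {R m n V : Type*} [CommRing R] [Fintype m] [DecidableEq m] [Fintype n] [DecidableEq n]
  [Fintype V] [DecidableEq V]

theorem commute_schurComplement {m : Type*} [Fintype m] {A J : Matrix m m R} {B : Matrix m n R}
    {C : Matrix n m R} {W J' : Matrix n n R}
    (h : Commute (fromBlocks A B C W) (fromBlocks J 0 0 J')) (hW : IsUnit W.det) :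
    Commute (A - B * W⁻¹ * C) J := by
  simp only [Commute, SemiconjBy, fromBlocks_multiply, fromBlocks_inj, Matrix.mul_zero,
    Matrix.zero_mul, add_zero, zero_add] at h
  obtain ⟨hA, hB, hC, hW'⟩ := h
  have hinv : J' * W⁻¹ = W⁻¹ * J' := by
    calc J' * W⁻¹ = W⁻¹ * (W * J') * W⁻¹ := by rw [nonsing_inv_mul_cancel_left _ _ hW]
      _ = W⁻¹ * J' := by rw [hW', ← Matrix.mul_assoc, mul_nonsing_inv_cancel_right _ _ hW]
  have hBC : B * W⁻¹ * C * J = J * (B * W⁻¹ * C) := by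
    simp only [Matrix.mul_assoc, hC]
    simp only [← Matrix.mul_assoc, ← hB]
    simp only [Matrix.mul_assoc, hinv]
  exact .sub_left hA hBC

theorem det_mul_fromBlocks_mul_add (P A P' E : Matrix m m R) (B : Matrix m n R) (C : Matrix n m R)
    {W : Matrix n n R} (hW : IsUnit W.det) :
    (fromBlocks P 0 0 1 * fromBlocks A B C W * fromBlocks P' 0 0 1 + fromBlocks E 0 0 0).det =
      W.det * (P * (A - B * W⁻¹ * C) * P' + E).det := by
  have := W.invertibleOfIsUnitDet hW
  simp only [fromBlocks_multiply, fromBlocks_add, Matrix.mul_zero, Matrix.zero_mul, add_zero,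
    zero_add, Matrix.one_mul, Matrix.mul_one, det_fromBlocks₂₂, invOf_eq_nonsing_inv]
  congr 2
  simp only [Matrix.mul_sub, Matrix.sub_mul, Matrix.mul_assoc, sub_add_eq_add_sub]

theorem det_add_sub_det_merge_fin_two {S E : Matrix (Fin 2) (Fin 2) R} (h01 : S 0 1 = 0)
    (h10 : S 1 0 = 0) (hE : E 0 0 = E 1 1) :
    (S + E).det - (!![1, 1; 0, 0] * S * !![1, 1; 0, 0]ᵀ + E).det = S.det := by
  simp only [det_fin_two, Matrix.add_apply, mul_apply, transpose_apply, Fin.sum_univ_two, of_apply,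
    cons_val', cons_val_zero, cons_val_one, cons_val_fin_one, h01, h10, hE]
  ring

theorem det_fromBlocks_add_sub_det_merge {A E : Matrix (Fin 2) (Fin 2) R} {B : Matrix (Fin 2) n R}
    {C : Matrix n (Fin 2) R} {W J : Matrix n n R} {d : Fin 2 → R}
    (h : Commute (fromBlocks A B C W) (fromBlocks (diagonal d) 0 0 J))
    (hd : IsUnit (d 0 - d 1)) (hE : E 0 0 = E 1 1) (hW : IsUnit W.det) :
    (fromBlocks A B C W + fromBlocks E 0 0 0).det -
      (fromBlocks !![1, 1; 0, 0] 0 0 1 * fromBlocks A B C W * fromBlocks !![1, 1; 0, 0]ᵀ 0 0 1 +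
        fromBlocks E 0 0 0).det = (fromBlocks A B C W).det := by
  -- the Schur complement is diagonal because it commutes with `diagonal d`, where `d 0 ≠ d 1`
  have hS := commute_schurComplement h hW
  set S := A - B * W⁻¹ * C
  have h01 : S 0 1 = 0 := hd.mul_right_eq_zero.1 <| by
    have := congrFun₂ hS.eq 0 1
    simp only [mul_diagonal, diagonal_mul] at this
    linear_combination -this
  have h10 : S 1 0 = 0 := hd.mul_right_eq_zero.1 <| by
    have := congrFun₂ hS.eq 1 0
    simp only [mul_diagonal, diagonal_mul] at this
    linear_combination this
  have hdet (E' : Matrix (Fin 2) (Fin 2) R) :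
      (fromBlocks A B C W + fromBlocks E' 0 0 0).det = W.det * (S + E').det := by
    simpa [S, fromBlocks_one] using det_mul_fromBlocks_mul_add 1 A 1 E' B C hW
  have hdet0 : (fromBlocks A B C W).det = W.det * S.det := by simpa using hdet 0
  rw [hdet, det_mul_fromBlocks_mul_add _ _ _ _ _ _ hW, hdet0, ← mul_sub,
    det_add_sub_det_merge_fin_two h01 h10 hE]

theorem bijective_sumElim_pair {α : Type*} {u v : α} (huv : u ≠ v) :
    Function.Bijective (Sum.elim ![u, v] ((↑) : {c // c ≠ u ∧ c ≠ v} → α)) := by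
  constructor
  · refine .sumElim (injective_pair_iff_ne.2 huv) Subtype.val_injective fun i c => ?_
    fin_cases i
    exacts [c.2.1.symm, c.2.2.symm]
  · intro c
    by_cases hu : c = u
    · exact ⟨.inl 0, hu.symm⟩
    by_cases hv : c = v
    · exact ⟨.inl 1, hv.symm⟩
    exact ⟨.inr ⟨c, hu, hv⟩, rfl⟩

/-- The matrix of the linear map on `R`-valued functions which pushes the standard basis forward
along `f`, that is, which sums functions over the fibres of `f`. -/
def pushforwardMatrix (R : Type*) [Zero R] [One R] (f : m → n) : Matrix n m R :=
  (1 : Matrix n n R).submatrix id f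

theorem pushforwardMatrix_mulVec_single {n : Type*} [DecidableEq n] (f : m → n) (a : m) :
    pushforwardMatrix R f *ᵥ Pi.single a 1 = Pi.single (f a) 1 := by
  ext b
  simp [pushforwardMatrix, one_apply, Pi.single_apply]

theorem map_pushforwardMatrix {m n S : Type*} [DecidableEq n] [CommRing S] (φ : R →+* S)
    (f : m → n) : (pushforwardMatrix R f).map φ = pushforwardMatrix S f := by
  ext a b
  simp [pushforwardMatrix, one_apply, apply_ite φ]

theorem pushforwardMatrix_update_mul_diagonal {u v : V} {d : V → R} (hv : d v = 0) :
    pushforwardMatrix R (Function.update id v u) * diagonal d = diagonal d := by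
  ext a b
  by_cases hb : b = v
  · simp +contextual [hb, hv, diagonal_apply]
  · by_cases hab : a = b <;> simp [pushforwardMatrix, one_apply, hb, hab]

theorem pushforwardMatrix_update_submatrix_pair {V : Type*} [DecidableEq V] {u v : V}
    (huv : u ≠ v) :
    (pushforwardMatrix R (Function.update id v u)).submatrix
      (Sum.elim ![u, v] (Subtype.val : {c // c ≠ u ∧ c ≠ v} → V))
      (Sum.elim ![u, v] (Subtype.val : {c // c ≠ u ∧ c ≠ v} → V)) =
        fromBlocks !![1, 1; 0, 0] 0 0 1 := by
  ext (i | i) (j | j)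
  · fin_cases i <;> fin_cases j <;> simp [pushforwardMatrix, one_apply, huv, huv.symm]
  · fin_cases i <;> simp [pushforwardMatrix, j.2, j.2.1.symm, j.2.2.symm]
  · fin_cases j <;> simp [pushforwardMatrix, i.2, huv]
  · simp [pushforwardMatrix, j.2, one_apply, Subtype.ext_iff]

theorem det_add_sub_det_merge_add_of_isUnit {u v : V} (huv : u ≠ v) {N E : Matrix V V R}
    {d : V → R} (hN : Commute N (diagonal d)) (hd : IsUnit (d u - d v))
    (hEl : ∀ a b, a ≠ u → a ≠ v → E a b = 0) (hEr : ∀ a b, b ≠ u → b ≠ v → E a b = 0)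
    (hE : E u u = E v v)
    (hW : IsUnit (N.submatrix (↑) (↑) : Matrix {c // c ≠ u ∧ c ≠ v} _ R).det) :
    (N + E).det - (pushforwardMatrix R (Function.update id v u) * N *
      (pushforwardMatrix R (Function.update id v u))ᵀ + E).det = N.det := by
  let e := Equiv.ofBijective _ (bijective_sumElim_pair huv)
  have hNe := (fromBlocks_toBlocks (N.submatrix e e)).symm
  have hEe : E.submatrix e e = fromBlocks (E.submatrix ![u, v] ![u, v]) 0 0 0 := by
    ext (i | i) (j | j)
    · rfl
    · exact hEr _ _ j.2.1 j.2.2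
    · exact hEl _ _ i.2.1 i.2.2
    · exact hEr _ _ j.2.1 j.2.2
  have hPe : (pushforwardMatrix R (Function.update id v u)).submatrix e e =
      fromBlocks !![1, 1; 0, 0] 0 0 1 := pushforwardMatrix_update_submatrix_pair huv
  have hPt : ((pushforwardMatrix R (Function.update id v u))ᵀ).submatrix e e =
      fromBlocks !![1, 1; 0, 0]ᵀ 0 0 1 := by
    rw [← transpose_submatrix, hPe, fromBlocks_transpose, transpose_zero, transpose_zero,
      transpose_one]
  have hde : (diagonal d).submatrix e e =
      fromBlocks (diagonal ![d u, d v]) 0 0 (diagonal fun c : {c // c ≠ u ∧ c ≠ v} => d c) := by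
    rw [submatrix_diagonal_equiv, fromBlocks_diagonal]
    congr 1
    ext (i | i)
    · fin_cases i <;> rfl
    · rfl
  have hcomm : Commute (N.submatrix e e) ((diagonal d).submatrix e e) := by
    rw [Commute, SemiconjBy, submatrix_mul_equiv, submatrix_mul_equiv, hN.eq]
  rw [hNe, hde] at hcomm
  have key := det_fromBlocks_add_sub_det_merge hcomm (E := E.submatrix ![u, v] ![u, v]) hd hE hW
  rw [← hNe, ← hEe, ← hPe, ← hPt, submatrix_mul_equiv, submatrix_mul_equiv] at key
  rwa [← det_submatrix_equiv_self e (N + E), ← det_submatrix_equiv_self e (_ + E),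
    ← det_submatrix_equiv_self e N]

theorem det_diagonal_add (d : V → R) (K : Matrix V V R) :
    (diagonal d + K).det =
      ∑ s : Finset V, (∏ a ∈ sᶜ, d a) * (K.submatrix (↑) (↑) : Matrix s s R).det := by
  rw [add_comm]
  refine (detRowAlternating.map_add_univ K.row (diagonal d).row).trans
    (Finset.sum_congr rfl fun s _ => ?_)
  have hrows : of (s.piecewise K.row (diagonal d).row) = of fun a b =>
      (if a ∈ s then 1 else d a) * of (s.piecewise K.row (1 : Matrix V V R).row) a b := by
    ext a b
    by_cases ha : a ∈ s <;> simp [ha, diagonal_apply, one_apply]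
  change (of (s.piecewise K.row (diagonal d).row)).det = _
  rw [hrows, det_mul_column, det_piecewise_one_eq_submatrix_det, Finset.prod_ite,
    Finset.prod_const_one, one_mul, Finset.filter_notMem_eq_sdiff, Finset.compl_eq_univ_sdiff]

theorem det_add_sub_det_merge_add {u v : V} (huv : u ≠ v) {N E : Matrix V V R} {d : V → R}
    (hN : Commute N (diagonal d)) (hd : IsUnit (d u - d v))
    (hEl : ∀ a b, a ≠ u → a ≠ v → E a b = 0) (hEr : ∀ a b, b ≠ u → b ≠ v → E a b = 0)
    (hE : E u u = E v v)
    (hW : (N.submatrix (↑) (↑) : Matrix {c // c ≠ u ∧ c ≠ v} _ R).det ∈ nonZeroDivisors R) :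
    (N + E).det - (pushforwardMatrix R (Function.update id v u) * N *
      (pushforwardMatrix R (Function.update id v u))ᵀ + E).det = N.det := by
  let φ := algebraMap R (FractionRing R)
  apply IsFractionRing.injective R (FractionRing R)
  have key := det_add_sub_det_merge_add_of_isUnit huv (N := φ.mapMatrix N) (E := φ.mapMatrix E)
    (d := fun a => φ (d a)) (by simpa [diagonal_map] using hN.map φ.mapMatrix)
    (by simpa using hd.map φ) (fun a b h h' => by simp [hEl a b h h'])
    (fun a b h h' => by simp [hEr a b h h']) (by simp [hE])
    (by simpa [φ, RingHom.map_det, submatrix_map] using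
      IsLocalization.map_units (FractionRing R) ⟨_, hW⟩)
  simpa only [map_sub, RingHom.map_det, map_add, map_mul, RingHom.mapMatrix_apply,
    map_pushforwardMatrix, transpose_map] using key

theorem charpoly_add_sub_charpoly_merge_add {u v : V} (huv : u ≠ v) {K E : Matrix V V R}
    {d : V → R} (hK : Commute K (diagonal d)) (hd : IsUnit (d u - d v))
    (hEl : ∀ a b, a ≠ u → a ≠ v → E a b = 0) (hEr : ∀ a b, b ≠ u → b ≠ v → E a b = 0)
    (hE : E u u = E v v) :
    (K + E).charpoly - (pushforwardMatrix R (Function.update id v u) * K *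
        (pushforwardMatrix R (Function.update id v u))ᵀ + E).charpoly =
      (diagonal (fun a => if a ∈ ({u, v} : Finset V) then 0 else (X : R[X])) - K.map C).det := by
  set δ : V → R[X] := fun a => if a ∈ ({u, v} : Finset V) then 0 else X
  set ε : V → R[X] := fun a => if a ∈ ({u, v} : Finset V) then X else 0
  let P := pushforwardMatrix R[X] (Function.update id v u)
  have hchar (L : Matrix V V R) :
      (L + E).charpoly = (diagonal δ - L.map C + (diagonal ε - E.map C)).det := by
    have hX : scalar V (X : R[X]) = diagonal δ + diagonal ε := by
      rw [scalar_apply, diagonal_add]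
      congr! with a
      by_cases ha : a ∈ ({u, v} : Finset V) <;>
        simp only [δ, ε, ha, if_true, if_false, zero_add, add_zero]
    rw [charpoly, charmatrix, hX, map_add, RingHom.mapMatrix_apply, RingHom.mapMatrix_apply,
      add_sub_add_comm]
  have hP : P * diagonal δ = diagonal δ :=
    pushforwardMatrix_update_mul_diagonal (by simp [δ])
  have hPt : diagonal δ * Pᵀ = diagonal δ := by
    simpa using congrArg transpose hP
  have hPK : P * (diagonal δ - K.map C) * Pᵀ = diagonal δ -
      (pushforwardMatrix R (Function.update id v u) * K *
        (pushforwardMatrix R (Function.update id v u))ᵀ).map C := by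
    rw [Matrix.mul_sub, Matrix.sub_mul, hP, hPt, Matrix.map_mul, Matrix.map_mul, transpose_map,
      map_pushforwardMatrix]
  rw [hchar, hchar, ← hPK]
  refine det_add_sub_det_merge_add huv (d := fun a => C (d a)) ?_ ?_ ?_ ?_ ?_ ?_
  · refine .sub_left (commute_diagonal _ _) ?_
    simpa [diagonal_map] using hK.map (C : R →+* R[X]).mapMatrix
  · simpa using hd.map C
  · intro a b hu hv
    simp [ε, hu, hv, hEl, diagonal_apply]
  · intro a b hu hv
    by_cases hab : a = b <;> simp [ε, hu, hv, hEr, hab]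
  · simp [ε, hE]
  · -- the minor off `{u, v}` is a characteristic polynomial, hence monic
    convert (K.submatrix ((↑) : {c // c ≠ u ∧ c ≠ v} → V) (↑)).charpoly_monic.mem_nonZeroDivisors
    rw [charpoly]
    congr 1
    ext a b : 2
    simp [δ, a.2, charmatrix_apply, diagonal_apply, Subtype.ext_iff]

theorem coeff_det_diagonal_sub_map_C (t : Finset V) (K : Matrix V V R) {i : ℕ}
    (hi : i ≤ Fintype.card V) :
    (-1) ^ i * (diagonal (fun a => if a ∈ t then 0 else (X : R[X])) - K.map C).det.coeff
      (Fintype.card V - i) = ∑ s ∈ Finset.univ.powersetCard i with t ⊆ s,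
        (K.submatrix (↑) (↑) : Matrix s s R).det := by
  have hminor (s : Finset V) : ((-K.map C).submatrix (↑) (↑) : Matrix s s R[X]).det =
      C ((-1) ^ s.card * (K.submatrix (↑) (↑) : Matrix s s R).det) := by
    rw [submatrix_neg, Pi.neg_apply, Pi.neg_apply, det_neg, Fintype.card_coe, submatrix_map,
      ← RingHom.mapMatrix_apply, ← RingHom.map_det]
    simp
  have hprod (s : Finset V) : ∏ a ∈ sᶜ, (if a ∈ t then 0 else (X : R[X])) =
      if t ⊆ s then X ^ (Fintype.card V - s.card) else 0 := by
    simp only [← ite_not (p := _ ∈ t), Finset.prod_ite_zero, Finset.prod_const, Finset.card_compl]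
    congr! 1
    simp [Finset.subset_iff, not_imp_not]
  have hcoeff (s : Finset V) : (-1) ^ i * ((if t ⊆ s then X ^ (Fintype.card V - s.card) else 0) *
      C ((-1) ^ s.card * (K.submatrix (↑) (↑) : Matrix s s R).det)).coeff (Fintype.card V - i) =
      if s.card = i ∧ t ⊆ s then (K.submatrix (↑) (↑) : Matrix s s R).det else 0 := by
    have hcard : Fintype.card V - i = Fintype.card V - s.card ↔ s.card = i := by
      have := s.card_le_univ
      omega
    by_cases hts : t ⊆ s
    · simp only [hts, if_true, and_true, coeff_mul_C, coeff_X_pow, hcard]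
      split_ifs with hsi
      · rw [hsi, one_mul, ← mul_assoc, ← mul_pow, neg_one_mul, neg_neg, one_pow, one_mul]
      · simp
    · simp [hts]
  simp only [sub_eq_add_neg, det_diagonal_add, hminor, hprod, finsetSum_coeff, Finset.mul_sum,
    hcoeff]
  rw [Finset.sum_ite, Finset.sum_const_zero, add_zero]
  congr 1
  ext s
  simp

theorem det_submatrix_mul_transpose_nonneg {m n : Type*} [DecidableEq m] [Fintype n]
    (M : Matrix m n ℝ) (s : Finset m) :
    0 ≤ ((M * Mᵀ).submatrix (↑) (↑) : Matrix s s ℝ).det :=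
  (posSemidef_self_mul_conjTranspose (M.submatrix ((↑) : s → m) id)).det_nonneg

theorem det_submatrix_mul_transpose_eq_zero_iff {n : Type*} [Fintype n] (M : Matrix m n ℝ)
    (s : Finset m) :
    ((M * Mᵀ).submatrix (↑) (↑) : Matrix s s ℝ).det = 0 ↔
      ∃ x : m → ℝ, x ≠ 0 ∧ (∀ a ∉ s, x a = 0) ∧ x ᵥ* M = 0 := by
  have hN : (M * Mᵀ).submatrix (↑) (↑) =
      M.submatrix ((↑) : s → m) id * (M.submatrix ((↑) : s → m) id)ᴴ := rfl
  have hrestrict {x : m → ℝ} (hx : ∀ a ∉ s, x a = 0) :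
      (fun a : s => x a) ᵥ* M.submatrix (↑) id = x ᵥ* M := by
    ext e
    simp only [vecMul, dotProduct, submatrix_apply, id, Finset.sum_coe_sort s fun a => x a * M a e]
    exact Finset.sum_subset s.subset_univ fun a _ ha => by rw [hx a ha, zero_mul]
  simp only [hN, ← exists_vecMul_eq_zero_iff, vecMul_self_mul_conjTranspose_eq_zero]
  constructor
  · rintro ⟨y, hy, hyM⟩
    let x : m → ℝ := fun a => if h : a ∈ s then y ⟨a, h⟩ else 0
    have hxy : (fun a : s => x a) = y := by
      ext a
      simp [x]
    have hx : ∀ a ∉ s, x a = 0 := fun a ha => dif_neg ha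
    refine ⟨x, fun h => hy ?_, hx, by rw [← hrestrict hx, hxy, hyM]⟩
    rw [← hxy, h]
    rfl
  · rintro ⟨x, hx0, hx, hxM⟩
    refine ⟨fun a => x a, fun h => hx0 ?_, by rw [hrestrict hx, hxM]⟩
    ext a
    by_cases ha : a ∈ s
    · exact congrFun h ⟨a, ha⟩
    · exact hx a ha

end LinearAlgebra

section SignlessLaplacian

open SimpleGraph

variable {V W : Type*} {G H : SimpleGraph V} {u v : V}

theorem reachable_iff_of_adj (w : V) {a b : V} (hab : G.Adj a b) :
    G.Reachable w a ↔ G.Reachable w b :=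
  ⟨fun h => h.trans hab.reachable, fun h => h.trans hab.reachable.symm⟩

/-- A function which changes sign along every edge of the graph. On a finite graph these functions
form the kernel of the signless Laplacian. -/
def IsSignAlternating (G : SimpleGraph V) (x : V → ℝ) : Prop :=
  ∀ ⦃a b⦄, G.Adj a b → x a = -x b

theorem isSignAlternating_apply_eq_zero_iff_of_reachable {x : V → ℝ} (hx : IsSignAlternating G x)
    {a b : V} (h : G.Reachable a b) : x a = 0 ↔ x b = 0 := by
  obtain ⟨p⟩ := h
  induction p with
  | nil => rfl
  | cons hab _ ih => rw [hx hab, neg_eq_zero, ih]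

theorem isBipartite_of_isSignAlternating {x : V → ℝ} (hx : IsSignAlternating G x)
    (hx0 : ∀ a, x a ≠ 0) : G.IsBipartite := by
  refine (Coloring.mk (fun a => decide (0 < x a)) fun {a b} hab h => ?_ : G.Coloring Bool).colorable
  rw [decide_eq_decide, hx hab, neg_pos] at h
  grind

theorem exists_isSignAlternating_iff (s : Set V) :
    (∃ x, x ≠ 0 ∧ (∀ a ∉ s, x a = 0) ∧ IsSignAlternating G x) ↔
      ∃ c : G.ConnectedComponent, c.supp ⊆ s ∧ c.toSimpleGraph.IsBipartite := by
  constructor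
  · rintro ⟨x, hx0, hxs, hx⟩
    obtain ⟨a, ha⟩ := Function.ne_iff.1 hx0
    have hne (b) (hb : b ∈ (G.connectedComponentMk a).supp) : x b ≠ 0 := fun h =>
      ha ((isSignAlternating_apply_eq_zero_iff_of_reachable hx
        (ConnectedComponent.eq.1 hb)).1 h)
    exact ⟨G.connectedComponentMk a, fun b hb => not_imp_comm.1 (hxs b) (hne b hb),
      isBipartite_of_isSignAlternating (fun _ _ h => hx h) fun b => hne b b.2⟩
  · classical
    rintro ⟨c, hcs, ⟨C⟩⟩
    obtain ⟨a, ha⟩ := c.nonempty_supp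
    refine ⟨fun b => if h : b ∈ c.supp then (-1) ^ (C ⟨b, h⟩ : ℕ) else 0, ?_, ?_, ?_⟩
    · exact Function.ne_iff.2 ⟨a, by simp [ha]⟩
    · exact fun b hb => dif_neg fun h => hb (hcs h)
    · intro b d hbd
      have hmem : b ∈ c.supp ↔ d ∈ c.supp := c.mem_supp_congr_adj hbd
      by_cases hb : b ∈ c.supp
      · have hC := C.valid (v := ⟨b, hb⟩) (w := ⟨d, hmem.1 hb⟩) hbd
        simp only [hb, hmem.1 hb, dif_pos]
        generalize C ⟨b, hb⟩ = i at *
        generalize C ⟨d, _⟩ = j at *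
        fin_cases i <;> fin_cases j <;> simp_all
      · simp [hb, mt hmem.2 hb]

variable [DecidableEq V]

theorem update_id_ne_of_adj (hb : ¬H.Reachable u v) {a b : V} (hab : H.Adj a b) :
    Function.update id v u a ≠ Function.update id v u b := by
  have := reachable_iff_of_adj u hab
  have := hab.ne
  have := Reachable.refl (G := H) u
  grind [Function.update_apply]

theorem injOn_map_update_id (hb : ¬H.Reachable u v) :
    Set.InjOn (Sym2.map (Function.update id v u)) H.edgeSet := by
  have := Reachable.refl (G := H) u
  intro e he e' he'
  induction e with | h a b
  induction e' with | h c d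
  have := reachable_iff_of_adj u he
  have := reachable_iff_of_adj u he'
  have := H.ne_of_adj he
  have := H.ne_of_adj he'
  simp only [Sym2.map_mk, Sym2.eq_iff, Function.update_apply, id]
  grind

theorem contractAttach_eq_map_deleteEdges_sup :
    G.contractAttach u v =
      (G.deleteEdges {s(u, v)}).map (Function.update id v u) ⊔ edge u v := by
  have hf : (fun x => if x = v then u else x) = Function.update id v u := by
    ext x
    simp [Function.update_apply]
  trans G.map (Function.update id v u) ⊔ edge u v
  · rw [← hf]
    exact congrArg (· ⊔ edge u v) (by congr!)
  congr 1
  ext a b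
  simp only [map_adj', deleteEdges_adj, Set.mem_singleton_iff]
  refine and_congr_right fun hab => ⟨?_, ?_⟩
  · rintro ⟨c, d, hcd, rfl, rfl⟩
    refine ⟨c, d, ⟨hcd, fun h => hab ?_⟩, rfl, rfl⟩
    rcases Sym2.eq_iff.1 h with ⟨rfl, rfl⟩ | ⟨rfl, rfl⟩ <;> simp [Function.update_apply]
  · rintro ⟨c, d, hcd, rfl, rfl⟩
    exact ⟨c, d, hcd.1, rfl, rfl⟩

/-- The vector `e_a + e_b` attached to an edge `ab`: the corresponding column of the unsigned
incidence matrix. -/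
noncomputable def edgeVector : Sym2 V → V → ℝ :=
  Sym2.lift ⟨fun a b => Pi.single a 1 + Pi.single b 1, fun _ _ => add_comm _ _⟩

theorem edgeVector_mk (a b : V) : edgeVector s(a, b) = Pi.single a 1 + Pi.single b 1 := rfl

theorem incMatrix_apply_of_mem_edgeSet [DecidableRel G.Adj] {e : Sym2 V} (he : e ∈ G.edgeSet)
    (a : V) : G.incMatrix ℝ a e = edgeVector e a := by
  induction e with
  | h b c =>
    have := G.ne_of_adj he
    by_cases hb : a = b <;> by_cases hc : a = c <;>
      simp_all [incMatrix_apply', edgeVector_mk, mk'_mem_incidenceSet_iff]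

variable [Fintype V]

theorem pushforwardMatrix_mulVec_edgeVector [DecidableEq W] (f : V → W) (e : Sym2 V) :
    pushforwardMatrix ℝ f *ᵥ edgeVector e = edgeVector (e.map f) := by
  induction e with
  | h a b =>
    rw [Sym2.map_mk, edgeVector_mk, edgeVector_mk, mulVec_add, pushforwardMatrix_mulVec_single,
      pushforwardMatrix_mulVec_single]

theorem signlessLapMatrix_eq_incMatrix_mul_transpose [DecidableRel G.Adj] :
    G.signlessLapMatrix = G.incMatrix ℝ * (G.incMatrix ℝ)ᵀ := by
  rw [incMatrix_mul_transpose]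
  ext a b
  by_cases hab : a = b
  · simp only [signlessLapMatrix, degMatrix, hab, Matrix.add_apply, diagonal_apply_eq,
      adjMatrix_apply, SimpleGraph.irrefl, if_false, add_zero, of_apply, if_true]
    congr!
  · simp [signlessLapMatrix, degMatrix, adjMatrix_apply, hab]

theorem signlessLapMatrix_eq_sum [Fintype G.edgeSet] :
    G.signlessLapMatrix = ∑ e ∈ G.edgeFinset, vecMulVec (edgeVector e) (edgeVector e) := by
  classical
  rw [signlessLapMatrix_eq_incMatrix_mul_transpose]
  ext a b
  rw [Matrix.sum_apply, mul_apply, ← Finset.sum_subset G.edgeFinset.subset_univ]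
  · refine Finset.sum_congr rfl fun e he => ?_
    rw [transpose_apply, vecMulVec_apply, incMatrix_apply_of_mem_edgeSet (mem_edgeFinset.1 he),
      incMatrix_apply_of_mem_edgeSet (mem_edgeFinset.1 he)]
  · intro e _ he
    rw [incMatrix_of_notMem_incidenceSet, zero_mul]
    exact fun h => he (mem_edgeFinset.2 h.1)

theorem signlessLapMatrix_sup {V : Type*} [Fintype V] {G H : SimpleGraph V} (h : Disjoint G H) :
    (G ⊔ H).signlessLapMatrix = G.signlessLapMatrix + H.signlessLapMatrix := by
  classical
  rw [signlessLapMatrix_eq_sum, signlessLapMatrix_eq_sum, signlessLapMatrix_eq_sum,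
    ← Finset.sum_union (disjoint_edgeFinset.2 h), edgeFinset_sup]

theorem signlessLapMatrix_edge (huv : u ≠ v) :
    (edge u v).signlessLapMatrix = vecMulVec (edgeVector s(u, v)) (edgeVector s(u, v)) := by
  rw [signlessLapMatrix_eq_sum, ← Finset.sum_singleton (fun e => vecMulVec (edgeVector e) _)]
  congr!
  ext e
  simp [edgeSet_edge_of_ne huv]

theorem signlessLapMatrix_map {V : Type*} [Fintype V] [Fintype W] [DecidableEq W]
    {G : SimpleGraph V} {f : V → W} (hf : Set.InjOn (Sym2.map f) G.edgeSet)
    (hadj : ∀ ⦃a b⦄, G.Adj a b → f a ≠ f b) :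
    (G.map f).signlessLapMatrix =
      pushforwardMatrix ℝ f * G.signlessLapMatrix * (pushforwardMatrix ℝ f)ᵀ := by
  classical
  have hedge : (G.map f).edgeFinset = G.edgeFinset.image (Sym2.map f) := by
    ext e
    induction e with
    | h a b =>
      simp only [mem_edgeFinset, mem_edgeSet, map_adj', Finset.mem_image, Sym2.exists, Sym2.map_mk,
        Sym2.eq_iff]
      constructor
      · rintro ⟨-, c, d, hcd, rfl, rfl⟩
        exact ⟨c, d, hcd, .inl ⟨rfl, rfl⟩⟩
      · rintro ⟨c, d, hcd, ⟨rfl, rfl⟩ | ⟨rfl, rfl⟩⟩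
        · exact ⟨hadj hcd, c, d, hcd, rfl, rfl⟩
        · exact ⟨(hadj hcd).symm, d, c, hcd.symm, rfl, rfl⟩
  rw [signlessLapMatrix_eq_sum, signlessLapMatrix_eq_sum, hedge,
    Finset.sum_image (by simpa using hf), Matrix.mul_sum, Matrix.sum_mul]
  refine Finset.sum_congr rfl fun e _ => ?_
  rw [mul_vecMulVec, vecMulVec_mul, vecMul_transpose, pushforwardMatrix_mulVec_edgeVector]

theorem signlessLapMatrix_eq_deleteEdges_add (huv : G.Adj u v) :
    G.signlessLapMatrix = (G.deleteEdges {s(u, v)}).signlessLapMatrix +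
      vecMulVec (edgeVector s(u, v)) (edgeVector s(u, v)) := by
  have hle : edge u v ≤ G := (edge_le_iff _).2 (.inr huv)
  conv_lhs => rw [← sdiff_sup_cancel hle, signlessLapMatrix_sup disjoint_sdiff_self_left,
    signlessLapMatrix_edge huv.ne]
  rfl

theorem signlessLapMatrix_contractAttach_eq_merge_add (huv : u ≠ v) (hb : G.IsBridge s(u, v)) :
    (G.contractAttach u v).signlessLapMatrix =
      pushforwardMatrix ℝ (Function.update id v u) *
        (G.deleteEdges {s(u, v)}).signlessLapMatrix *
          (pushforwardMatrix ℝ (Function.update id v u))ᵀ +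
      vecMulVec (edgeVector s(u, v)) (edgeVector s(u, v)) := by
  rw [isBridge_iff] at hb
  have hdisj : Disjoint ((G.deleteEdges {s(u, v)}).map (Function.update id v u)) (edge u v) := by
    refine (disjoint_edge _).2 ?_
    rintro ⟨-, a, b, -, -, hbv⟩
    grind [Function.update_apply]
  rw [contractAttach_eq_map_deleteEdges_sup, signlessLapMatrix_sup hdisj,
    signlessLapMatrix_map (injOn_map_update_id hb) fun _ _ => update_id_ne_of_adj hb,
    signlessLapMatrix_edge huv]

theorem commute_signlessLapMatrix_diagonal_reachable (u : V) [DecidablePred (H.Reachable u)] :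
    Commute H.signlessLapMatrix (diagonal fun a => if H.Reachable u a then 1 else 0) := by
  ext a b
  rw [mul_diagonal, diagonal_mul, mul_comm]
  by_cases hab : a = b
  · rw [hab]
  by_cases hadj : H.Adj a b
  · simp only [reachable_iff_of_adj u hadj]
  · simp [signlessLapMatrix, degMatrix, hab, hadj]

theorem signlessLapCoeff_sub_signlessLapCoeff_contractAttach (huv : G.Adj u v)
    (hb : G.IsBridge s(u, v)) {i : ℕ} (hi : i ≤ Fintype.card V) :
    G.signlessLapCoeff i - (G.contractAttach u v).signlessLapCoeff i =
      ∑ s ∈ Finset.univ.powersetCard i with {u, v} ⊆ s,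
        ((G.deleteEdges {s(u, v)}).signlessLapMatrix.submatrix (↑) (↑) : Matrix s s ℝ).det := by
  classical
  have hb' := hb
  rw [isBridge_iff] at hb'
  have hzero {a : V} (hu : a ≠ u) (hv : a ≠ v) : edgeVector s(u, v) a = 0 := by
    simp [edgeVector_mk, hu, hv]
  rw [← coeff_det_diagonal_sub_map_C _ _ hi, ← charpoly_add_sub_charpoly_merge_add huv.ne
    (E := vecMulVec (edgeVector s(u, v)) (edgeVector s(u, v)))
    (commute_signlessLapMatrix_diagonal_reachable u) (by simp [hb'])
    (fun a b hu hv => by rw [vecMulVec_apply, hzero hu hv, zero_mul])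
    (fun a b hu hv => by rw [vecMulVec_apply, hzero hu hv, mul_zero])
    (by simp [vecMulVec_apply, edgeVector_mk, huv.ne, huv.ne.symm]),
    ← signlessLapMatrix_eq_deleteEdges_add huv,
    ← signlessLapMatrix_contractAttach_eq_merge_add huv.ne hb, coeff_sub, mul_sub]
  rw [signlessLapCoeff, signlessLapCoeff]
  congr!

theorem vecMul_incMatrix_eq_zero_iff [DecidableRel G.Adj] (x : V → ℝ) :
    x ᵥ* G.incMatrix ℝ = 0 ↔ IsSignAlternating G x := by
  have hedge {a b : V} (hab : G.Adj a b) : (x ᵥ* G.incMatrix ℝ) s(a, b) = x a + x b := by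
    simp only [vecMul, dotProduct]
    rw [← dotProduct_single_one x a, ← dotProduct_single_one x b, ← dotProduct_add]
    exact Finset.sum_congr rfl fun c _ => by rw [incMatrix_apply_of_mem_edgeSet hab]; rfl
  constructor
  · intro h a b hab
    rw [← add_eq_zero_iff_eq_neg, ← hedge hab, h, Pi.zero_apply]
  · intro h
    ext e
    induction e with | h a b
    by_cases hab : G.Adj a b
    · rw [hedge hab, Pi.zero_apply, add_eq_zero_iff_eq_neg, h hab]
    · refine Finset.sum_eq_zero fun c _ => mul_eq_zero_of_right _ ?_
      exact incMatrix_of_notMem_incidenceSet _ fun hc => hab hc.1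

theorem det_signlessLapMatrix_submatrix_nonneg (s : Finset V) :
    0 ≤ (G.signlessLapMatrix.submatrix (↑) (↑) : Matrix s s ℝ).det := by
  classical
  rw [signlessLapMatrix_eq_incMatrix_mul_transpose]
  exact det_submatrix_mul_transpose_nonneg _ s

theorem det_signlessLapMatrix_submatrix_eq_zero_iff (s : Finset V) :
    (G.signlessLapMatrix.submatrix (↑) (↑) : Matrix s s ℝ).det = 0 ↔
      ∃ c : G.ConnectedComponent, c.supp ⊆ s ∧ c.toSimpleGraph.IsBipartite := by
  classical
  rw [signlessLapMatrix_eq_incMatrix_mul_transpose, det_submatrix_mul_transpose_eq_zero_iff,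
    ← exists_isSignAlternating_iff]
  simp only [vecMul_incMatrix_eq_zero_iff, Finset.mem_coe]

end SignlessLaplacian

section Bridges

open SimpleGraph

variable {V : Type*} {G : SimpleGraph V} {u v : V}

theorem signlessLapCoeff_contractAttach_le [Fintype V] (huv : G.Adj u v) (hb : G.IsBridge s(u, v))
    {i : ℕ} (hi : i ≤ Fintype.card V) :
    (G.contractAttach u v).signlessLapCoeff i ≤ G.signlessLapCoeff i := by
  classical
  rw [← sub_nonneg, signlessLapCoeff_sub_signlessLapCoeff_contractAttach huv hb hi]
  exact Finset.sum_nonneg fun s _ => det_signlessLapMatrix_submatrix_nonneg s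

theorem signlessLapCoeff_eq_signlessLapCoeff_contractAttach_iff [Fintype V]
    (huv : G.Adj u v) (hb : G.IsBridge s(u, v)) {i : ℕ} (hi : i ≤ Fintype.card V) :
    G.signlessLapCoeff i = (G.contractAttach u v).signlessLapCoeff i ↔
      ∀ s : Finset V, s.card = i → u ∈ s → v ∈ s →
        ∃ c : (G.deleteEdges {s(u, v)}).ConnectedComponent,
          c.supp ⊆ s ∧ c.toSimpleGraph.IsBipartite := by
  classical
  rw [← sub_eq_zero, signlessLapCoeff_sub_signlessLapCoeff_contractAttach huv hb hi,
    Finset.sum_eq_zero_iff_of_nonneg fun s _ => det_signlessLapMatrix_submatrix_nonneg s]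
  simp only [det_signlessLapMatrix_submatrix_eq_zero_iff, Finset.mem_filter,
    Finset.mem_powersetCard, Finset.subset_univ, true_and, and_imp, Finset.insert_subset_iff,
    Finset.singleton_subset_iff]

theorem isAcyclic_induce_or_of_isUnicyclic (hG : G.IsUnicyclic) {s t : Set V}
    (hst : Disjoint s t) : (G.induce s).IsAcyclic ∨ (G.induce t).IsAcyclic := by
  have hcycle {s : Set V} (hs : ¬(G.induce s).IsAcyclic) :
      ∃ C ∈ G.cycleEdgeSets, (∃ a b, s(a, b) ∈ C) ∧ ∀ a b, s(a, b) ∈ C → a ∈ s := by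
    simp only [IsAcyclic, not_forall, not_not] at hs
    obtain ⟨a, p, hp⟩ := hs
    let f : G.induce s →g G := (Embedding.induce s).toHom
    refine ⟨{e | e ∈ (p.map f).edges}, ⟨_, p.map f, hp.map Subtype.val_injective, rfl⟩, ?_, ?_⟩
    · cases p with
      | nil => simp at hp
      | @cons a b c hab p => exact ⟨a, b, List.mem_cons_self⟩
    · intro b c hbc
      have := (p.map f).fst_mem_support_of_mem_edges hbc
      rw [Walk.support_map, List.mem_map] at this
      obtain ⟨b', -, rfl⟩ := this
      exact b'.2
  by_contra! ⟨hs, ht⟩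
  obtain ⟨C, hC, ⟨a, b, hab⟩, hCs⟩ := hcycle hs
  obtain ⟨D, hD, -, hDt⟩ := hcycle ht
  obtain rfl := hG.2.unique hC hD
  exact hst.notMem_of_mem_left (hCs a b hab) (hDt a b hab)

theorem connectedComponent_deleteEdges_eq_or (hG : G.Connected)
    (c : (G.deleteEdges {s(u, v)}).ConnectedComponent) :
    c = connectedComponentMk _ u ∨ c = connectedComponentMk _ v := by
  refine c.ind fun a => ?_
  simp only [ConnectedComponent.eq]
  have hua := hG.preconnected u a
  rw [reachable_iff_reflTransGen] at hua
  induction hua with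
  | refl => exact .inl .rfl
  | @tail b c _ hbc ih =>
    by_cases he : s(b, c) = s(u, v)
    · rcases Sym2.eq_iff.1 he with ⟨-, rfl⟩ | ⟨-, rfl⟩
      exacts [.inr .rfl, .inl .rfl]
    · have hcb := (deleteEdges_adj.2 ⟨hbc, he⟩ : (G.deleteEdges {s(u, v)}).Adj b c).symm.reachable
      exact ih.imp hcb.trans hcb.trans

theorem exists_adj_deleteEdges [Fintype (G.neighborSet u)] (huv : G.Adj u v)
    (hu : G.degree u ≠ 1) :
    ∃ a, (G.deleteEdges {s(u, v)}).Adj u a := by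
  by_contra! h
  refine hu (degree_eq_one_iff_existsUnique_adj.2 ⟨v, huv, fun a ha => ?_⟩)
  by_contra hav
  exact h a (deleteEdges_adj.2 ⟨ha, fun he => hav (Sym2.congr_right.1 he)⟩)

theorem isBipartite_deleteEdges_iff (hb : G.IsBridge s(u, v)) :
    (G.deleteEdges {s(u, v)}).IsBipartite ↔ G.IsBipartite := by
  classical
  refine ⟨fun ⟨C⟩ => ?_, fun h => h.mono_left (deleteEdges_le _)⟩
  rw [isBridge_iff] at hb
  let H := G.deleteEdges {s(u, v)}
  let D : V → Prop := fun a => if H.Reachable u a then C a = C u else C a ≠ C v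
  have hDu : D u := by simp [D]
  have hDv : ¬D v := by simp [D, H, hb]
  refine (Coloring.mk (fun a => decide (D a)) fun {a b} hab h => ?_ : G.Coloring Bool).colorable
  rw [decide_eq_decide] at h
  by_cases he : s(a, b) = s(u, v)
  · rcases Sym2.eq_iff.1 he with ⟨rfl, rfl⟩ | ⟨rfl, rfl⟩ <;> tauto
  · have hH : H.Adj a b := deleteEdges_adj.2 ⟨hab, he⟩
    have := C.valid hH
    simp only [D, reachable_iff_of_adj u hH] at h
    grind

theorem isBipartite_iff_connectedComponent_deleteEdges (hG : G.Connected)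
    (hb : G.IsBridge s(u, v)) :
    G.IsBipartite ↔
      ((G.deleteEdges {s(u, v)}).connectedComponentMk u).toSimpleGraph.IsBipartite ∧
      ((G.deleteEdges {s(u, v)}).connectedComponentMk v).toSimpleGraph.IsBipartite := by
  rw [← isBipartite_deleteEdges_iff hb, IsBipartite, colorable_iff_forall_connectedComponent]
  refine ⟨fun h => ⟨h _, h _⟩, fun h c => ?_⟩
  rcases connectedComponent_deleteEdges_eq_or hG c with rfl | rfl
  exacts [h.1, h.2]

theorem exists_connectedComponent_deleteEdges_iff (hG : G.Connected)
    {p : (G.deleteEdges {s(u, v)}).ConnectedComponent → Prop} :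
    (∃ c, p c) ↔ p (connectedComponentMk _ u) ∨ p (connectedComponentMk _ v) := by
  refine ⟨fun ⟨c, hc⟩ => ?_, fun h => h.elim (⟨_, ·⟩) (⟨_, ·⟩)⟩
  rcases connectedComponent_deleteEdges_eq_or hG c with rfl | rfl
  exacts [.inl hc, .inr hc]

theorem exists_isBipartite_connectedComponent_deleteEdges (hG : G.IsUnicyclic)
    (hb : G.IsBridge s(u, v)) :
    ∃ c : (G.deleteEdges {s(u, v)}).ConnectedComponent, c.toSimpleGraph.IsBipartite := by
  have hne : (G.deleteEdges {s(u, v)}).connectedComponentMk u ≠ connectedComponentMk _ v :=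
    fun h => isBridge_iff.1 hb (ConnectedComponent.eq.1 h)
  have hle (s : Set V) : (G.deleteEdges {s(u, v)}).induce s ≤ G.induce s :=
    comap_monotone _ (deleteEdges_le _)
  rw [exists_connectedComponent_deleteEdges_iff hG.1]
  exact (isAcyclic_induce_or_of_isUnicyclic hG
    (pairwise_disjoint_supp_connectedComponent _ hne)).imp
      (fun h => (h.anti (hle _)).isBipartite) fun h => (h.anti (hle _)).isBipartite

theorem exists_card_eq_not_subset_not_subset [Fintype V] {A B : Set V} (hAB : Disjoint A B)
    (hA : A.Nontrivial) (hB : B.Nontrivial) (hu : u ∈ A) (hv : v ∈ B) {i : ℕ} (h2 : 2 ≤ i)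
    (hi : i + 2 ≤ Fintype.card V) :
    ∃ s : Finset V, s.card = i ∧ u ∈ s ∧ v ∈ s ∧ ¬A ⊆ s ∧ ¬B ⊆ s := by
  classical
  obtain ⟨a, ha, hau⟩ := hA.exists_ne u
  obtain ⟨b, hb, hbv⟩ := hB.exists_ne v
  have huv : u ≠ v := hAB.ne_of_mem hu hv
  have hab : a ≠ b := hAB.ne_of_mem ha hb
  have hav : a ≠ v := hAB.ne_of_mem ha hv
  have hub : u ≠ b := hAB.ne_of_mem hu hb
  have havoid : ({u, v} : Finset V) ⊆ {a, b}ᶜ := by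
    simp [Finset.insert_subset_iff, hau.symm, hav.symm, hub, hbv.symm]
  obtain ⟨s, huvs, hsab, hs⟩ := Finset.exists_subsuperset_card_eq (n := i) havoid
    (by rwa [Finset.card_pair huv]) (by rw [Finset.card_compl, Finset.card_pair hab]; omega)
  refine ⟨s, hs, huvs (by simp), huvs (by simp), fun h => ?_, fun h => ?_⟩
  · simpa using hsab (h ha)
  · simpa using hsab (h hb)

theorem forall_card_add_one_eq_imp_subset_or_subset_iff [Fintype V] {A B : Set V}
    (hAB : Disjoint A B) (hA : A.Nontrivial) (hB : B.Nontrivial) (hu : u ∈ A) (hv : v ∈ B)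
    {P Q : Prop} {i : ℕ} (hi : i + 1 = Fintype.card V) :
    (∀ s : Finset V, s.card = i → u ∈ s → v ∈ s → A ⊆ s ∧ P ∨ B ⊆ s ∧ Q) ↔ P ∧ Q := by
  classical
  constructor
  · intro h
    obtain ⟨a, ha, hau⟩ := hA.exists_ne u
    obtain ⟨b, hb, hbv⟩ := hB.exists_ne v
    have hcompl (x : V) : ({x}ᶜ : Finset V).card = i := by
      rw [Finset.card_compl, Finset.card_singleton]
      omega
    have hP := (h {b}ᶜ (hcompl b) (by simpa using hAB.ne_of_mem hu hb)
      (by simpa using hbv.symm)).resolve_right fun hBs => by simpa using hBs.1 hb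
    have hQ := (h {a}ᶜ (hcompl a) (by simpa using hau.symm)
      (by simpa using (hAB.ne_of_mem ha hv).symm)).resolve_left fun hAs => by simpa using hAs.1 ha
    exact ⟨hP.2, hQ.2⟩
  · rintro ⟨hP, hQ⟩ s hs - -
    obtain ⟨e, he⟩ : ∃ e, sᶜ = {e} := Finset.card_eq_one.1 (by rw [Finset.card_compl]; omega)
    have hes {S : Set V} (heS : e ∉ S) : S ⊆ s := fun x hx => by
      by_contra hxs
      have : x ∈ sᶜ := Finset.mem_compl.2 hxs
      rw [he, Finset.mem_singleton] at this
      exact heS (this ▸ hx)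
    by_cases heA : e ∈ A
    · exact .inr ⟨hes (hAB.notMem_of_mem_left heA), hQ⟩
    · exact .inl ⟨hes heA, hP⟩

theorem forall_card_eq_imp_subset_or_subset_iff [Fintype V] {A B : Set V} (hAB : Disjoint A B)
    (hA : A.Nontrivial) (hB : B.Nontrivial) (hu : u ∈ A) (hv : v ∈ B) {P Q : Prop} {i : ℕ}
    (hi : i ≤ Fintype.card V) :
    (∀ s : Finset V, s.card = i → u ∈ s → v ∈ s → A ⊆ s ∧ P ∨ B ⊆ s ∧ Q) ↔
      i = 0 ∨ i = 1 ∨ (i = Fintype.card V - 1 ∧ P ∧ Q) ∨ (i = Fintype.card V ∧ (P ∨ Q)) := by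
  have huv : u ≠ v := hAB.ne_of_mem hu hv
  obtain hi2 | h2 := lt_or_ge i 2
  · refine iff_of_true (fun s hs hus hvs => ?_) (by omega)
    exact absurd (Finset.card_le_one.1 (by omega) u hus v hvs) huv
  obtain hlt | hpred | rfl : i + 2 ≤ Fintype.card V ∨ i + 1 = Fintype.card V ∨
      i = Fintype.card V := by
    omega
  · obtain ⟨s, hs, hus, hvs, hAs, hBs⟩ :=
      exists_card_eq_not_subset_not_subset hAB hA hB hu hv h2 hlt
    refine iff_of_false (fun h => ?_) (by omega)
    exact (h s hs hus hvs).elim (fun h => hAs h.1) fun h => hBs h.1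
  · rw [forall_card_add_one_eq_imp_subset_or_subset_iff hAB hA hB hu hv hpred]
    have : i ≠ 0 ∧ i ≠ 1 ∧ i ≠ Fintype.card V := by omega
    simp only [this, ← eq_tsub_of_add_eq hpred, false_or, true_and, false_and, or_false]
  · have : Fintype.card V ≠ 0 ∧ Fintype.card V ≠ 1 ∧ Fintype.card V ≠ Fintype.card V - 1 := by
      omega
    simp [Finset.card_eq_iff_eq_univ, this]

end Bridges

theorem theorem2p2_general {V : Type*} [Fintype V] (G : SimpleGraph V) (hG : G.Connected)
    (u v : V) (huv : G.Adj u v) (hpend : ¬ G.IsPendentEdge s(u, v)) (hb : G.IsBridge s(u, v))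
    (i : ℕ) (hi : i ≤ Fintype.card V) :
    (G.contractAttach u v).signlessLapCoeff i ≤ G.signlessLapCoeff i ∧
    (G.signlessLapCoeff i = (G.contractAttach u v).signlessLapCoeff i ↔
      i = 0 ∨ i = 1 ∨ (i = Fintype.card V - 1 ∧ G.IsBipartite) ∨ (i = Fintype.card V ∧
        ∃ c : (G.deleteEdges {s(u, v)}).ConnectedComponent, c.toSimpleGraph.IsBipartite)) := by
  classical
  refine ⟨signlessLapCoeff_contractAttach_le huv hb hi, ?_⟩
  obtain ⟨a, ha⟩ := exists_adj_deleteEdges huv fun h => hpend ⟨huv, u, by simp, by convert h⟩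
  obtain ⟨b, hvb⟩ := exists_adj_deleteEdges huv.symm fun h => hpend ⟨huv, v, by simp, by convert h⟩
  rw [Sym2.eq_swap] at hvb
  rw [signlessLapCoeff_eq_signlessLapCoeff_contractAttach_iff huv hb hi,
    isBipartite_iff_connectedComponent_deleteEdges hG hb]
  simp only [exists_connectedComponent_deleteEdges_iff hG]
  refine forall_card_eq_imp_subset_or_subset_iff
    (SimpleGraph.pairwise_disjoint_supp_connectedComponent _ ?_)
    ⟨u, rfl, a, ?_, ha.ne⟩ ⟨v, rfl, b, ?_, hvb.ne⟩ rfl rfl hi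
  · exact fun h => SimpleGraph.isBridge_iff.1 hb (SimpleGraph.ConnectedComponent.eq.1 h)
  · exact SimpleGraph.ConnectedComponent.eq.2 ha.symm.reachable
  · exact SimpleGraph.ConnectedComponent.eq.2 hvb.symm.reachable

theorem theorem2p2 {V : Type*} [Fintype V] (G : SimpleGraph V) (hG : G.IsUnicyclic)
    (u v : V) (huv : G.Adj u v) (hpend : ¬ G.IsPendentEdge s(u, v))
    (hcyc : ∀ C ∈ G.cycleEdgeSets, s(u, v) ∉ C) :
    ∀ i : ℕ, i ≤ Fintype.card V →
      (G.contractAttach u v).signlessLapCoeff i ≤ G.signlessLapCoeff i ∧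
      (¬ G.IsBipartite →
        (G.signlessLapCoeff i = (G.contractAttach u v).signlessLapCoeff i ↔
          i = 0 ∨ i = 1 ∨ i = Fintype.card V)) ∧
      (G.IsBipartite →
        (G.signlessLapCoeff i = (G.contractAttach u v).signlessLapCoeff i ↔
          i = 0 ∨ i = 1 ∨ i = Fintype.card V - 1 ∨ i = Fintype.card V)) := by
  intro i hi
  have hb : G.IsBridge s(u, v) := (SimpleGraph.isBridge_iff_forall_cycle_notMem huv).2
    fun w p hp => hcyc _ ⟨w, p, hp, rfl⟩
  have hbip := exists_isBipartite_connectedComponent_deleteEdges hG hb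
  obtain ⟨hle, heq⟩ := theorem2p2_general G hG.1 u v huv hpend hb i hi
  simp only [hbip, and_true] at heq
  exact ⟨hle, fun h => by simp [heq, h], fun h => by simp [heq, h]⟩
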